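/- Let $n\ge 0$ and regard $\mathbb{S}^n\times\mathbb{S}^n\subset\mathbb{R}^{n+1}\times\mathbb{R}^{n+1}=\mathbb{R}^{2n+2}$ as the product of two unit spheres with the induced metric, Levi-Civita connection $\bar\nabla$ (also used for the gradient of functions) and Laplacian $\bar\Delta=\operatorname{div}\bar\nabla$ (trace of the Hessian). Let $F$ be a smooth real-valued function on an open neighbourhood of $\mathbb{S}^n\times\mathbb{S}^n$ in $\mathbb{R}^{2n+2}$, and let $M=\{p\in\mathbb{S}^n\times\mathbb{S}^n: F(p)=c\}$ be a regular level set, i.e. $\bar\nabla F\neq0$ at every point of $M$, with unit normal $N=\bar\nabla F/|\bar\nabla F|$. Let $P(v_1,v_2)=(v_1,-v_2)$ be the product structure and $C=\langle PN,N\rangle$, and assume that $M$ is non-trivial, i.e. $C^2<1$ on $M$. Then at every point $p\in M$ the second fundamental form $B$ of $M\subset\mathbb{S}^n\times\mathbb{S}^n$ exists and is unique as the bilinear form on $T_pM$ with $B(u,V_p)=\langle\bar\nabla_uV,N\rangle$ for all $u\in T_pM$ and all smooth local vector fields $V$ tangent to $M$ along $M$, and its squared norm (the sum of the squares of its entries in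 an orthonormal basis of $T_pM$) is $$ \|B\|^2=\frac{1}{|\bar\nabla F|^2}\left(\frac12\bar\Delta|\bar\nabla F|^2-\langle\bar\nabla F,\bar\nabla\bar\Delta F\rangle-(n-1)|\bar\nabla F|^2-\frac{\left|\bar\nabla|\bar\nabla F|^2\right|^2}{2|\bar\nabla F|^2}+\frac{\left\langle\bar\nabla|\bar\nabla F|^2,\bar\nabla F\right\rangle^2}{4|\bar\nabla F|^4}\right). $$ -/

import Mathlib

open scoped ContDiff Topology

noncomputable section

namespace SphereProd

/-- The Euclidean space `ℝ^{n+1}`. -/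
abbrev Euc (n : ℕ) := EuclideanSpace ℝ (Fin (n + 1))

/-- The Euclidean space `ℝ^{2n+2} = ℝ^{n+1} × ℝ^{n+1}`: the coordinates of `p = (x, y)` indexed by
`Sum.inl i` are those of `x`, and the ones indexed by `Sum.inr i` are those of `y`. -/
abbrev Amb (n : ℕ) := EuclideanSpace ℝ (Fin (n + 1) ⊕ Fin (n + 1))

variable {n : ℕ}

/-- The first component `x` of `p = (x, y)`. -/
def fst (p : Amb n) : Euc n := WithLp.toLp 2 fun i => p (Sum.inl i)

/-- The second component `y` of `p = (x, y)`. -/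
def snd (p : Amb n) : Euc n := WithLp.toLp 2 fun i => p (Sum.inr i)

/-- The point `(x, y)` of `ℝ^{n+1} × ℝ^{n+1}`. -/
def pair (x y : Euc n) : Amb n := WithLp.toLp 2 (Sum.elim x y)

@[simp] theorem fst_pair (x y : Euc n) : fst (pair x y) = x := rfl

@[simp] theorem snd_pair (x y : Euc n) : snd (pair x y) = y := rfl

@[simp] theorem fst_add (p q : Amb n) : fst (p + q) = fst p + fst q := rfl

@[simp] theorem snd_add (p q : Amb n) : snd (p + q) = snd p + snd q := rfl

@[simp] theorem fst_sub (p q : Amb n) : fst (p - q) = fst p - fst q := rfl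

@[simp] theorem snd_sub (p q : Amb n) : snd (p - q) = snd p - snd q := rfl

@[simp] theorem fst_smul (r : ℝ) (p : Amb n) : fst (r • p) = r • fst p := rfl

@[simp] theorem snd_smul (r : ℝ) (p : Amb n) : snd (r • p) = r • snd p := rfl

@[simp] theorem fst_zero : fst (0 : Amb n) = 0 := rfl

@[simp] theorem snd_zero : snd (0 : Amb n) = 0 := rfl

theorem inner_eq (p q : Amb n) :
    inner ℝ p q = inner ℝ (fst p) (fst q) + inner ℝ (snd p) (snd q) := by
  simp [PiLp.inner_apply, fst, snd]

/-- `S^n × S^n ⊆ ℝ^{n+1} × ℝ^{n+1}`, the product of the two unit spheres. -/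
def sphereProd (n : ℕ) : Set (Amb n) := {p | ‖fst p‖ = 1 ∧ ‖snd p‖ = 1}

/-- The tangent space `T_{(x,y)}(S^n × S^n) = T_x S^n × T_y S^n = x^⊥ × y^⊥`. -/
def tangent (p : Amb n) : Submodule ℝ (Amb n) where
  carrier := {v | inner ℝ (fst p) (fst v) = 0 ∧ inner ℝ (snd p) (snd v) = 0}
  add_mem' := by
    rintro a b ⟨ha, ha'⟩ ⟨hb, hb'⟩
    simp [inner_add_right, ha, ha', hb, hb']
  zero_mem' := by simp
  smul_mem' := by
    rintro r a ⟨ha, ha'⟩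
    simp [inner_smul_right, ha, ha']

/-- The tangential projection `v ↦ v - ⟨v, x⟩ x - ⟨v, y⟩ y` at `p = (x, y)`, where `x`, `y` stand for
`(x, 0)`, `(0, y)`. For `p ∈ S^n × S^n` it is the orthogonal projection of `ℝ^{2n+2}` onto
`T_p(S^n × S^n)`, see `tangProj_eq_starProjection`. -/
def tangProj (p : Amb n) : Amb n →L[ℝ] Amb n :=
  ContinuousLinearMap.id ℝ (Amb n)
    - (innerSL ℝ (pair (fst p) 0)).smulRight (pair (fst p) 0)
    - (innerSL ℝ (pair 0 (snd p))).smulRight (pair 0 (snd p))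

theorem tangProj_eq_starProjection (p : Amb n) (hp : p ∈ sphereProd n) (v : Amb n) :
    tangProj p v = (tangent p).starProjection v := by
  obtain ⟨h1, h2⟩ := hp
  symm
  apply Submodule.eq_starProjection_of_mem_of_inner_eq_zero
  · constructor <;>
      simp [tangProj, inner_eq, inner_sub_right, inner_smul_right, h1, h2]
  · rintro w ⟨hw1, hw2⟩
    simp [tangProj, inner_eq, inner_smul_left, hw1, hw2]

/-- The gradient `∇̄ f` on `S^n × S^n` of (the restriction of) a function `f` defined near
`S^n × S^n`: the tangential part of the Euclidean gradient. At points of `S^n × S^n` it depends only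
on the restriction of `f` to `S^n × S^n`. -/
def grad (f : Amb n → ℝ) (p : Amb n) : Amb n := tangProj p (gradient f p)

/-- The Levi-Civita connection of `S^n × S^n`: `∇̄_u V` at `p` is the tangential part of the Euclidean
derivative of the vector field `V` in the direction `u`. -/
def covDeriv (V : Amb n → Amb n) (p u : Amb n) : Amb n := tangProj p (fderiv ℝ V p u)

/-- The Laplacian `Δ̄ f = div ∇̄ f` on `S^n × S^n`, the trace of `v ↦ ∇̄_v ∇̄ f` on `T_p(S^n × S^n)`.
It is computed as the trace over `ℝ^{2n+2}` of `v ↦ ∇̄_{v^T} ∇̄ f`, with `v^T` the tangential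
part of `v`; the normal directions contribute zero. -/
def laplacian (f : Amb n → ℝ) (p : Amb n) : ℝ :=
  LinearMap.trace ℝ (Amb n)
    (tangProj p ∘L fderiv ℝ (grad f) p ∘L tangProj p : Amb n →L[ℝ] Amb n).toLinearMap

/-- The function `|∇̄ F|²`. -/
def gradSq (F : Amb n → ℝ) (p : Amb n) : ℝ := ‖grad F p‖ ^ 2

/-- The level set `M = {p ∈ S^n × S^n | F p = c}`. -/
def levelSet (F : Amb n → ℝ) (c : ℝ) : Set (Amb n) := {p | p ∈ sphereProd n ∧ F p = c}

/-- The unit normal `N = ∇̄ F / |∇̄ F|` of the regular level sets of `F`. -/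
def unitNormal (F : Amb n → ℝ) (p : Amb n) : Amb n := ‖grad F p‖⁻¹ • grad F p

/-- The product structure `P (v₁, v₂) = (v₁, -v₂)`. -/
def prodStr (v : Amb n) : Amb n := pair (fst v) (-snd v)

/-- The product angle function `C = ⟨P N, N⟩`. -/
def angleFun (F : Amb n → ℝ) (p : Amb n) : ℝ :=
  inner ℝ (prodStr (unitNormal F p)) (unitNormal F p)

/-- The tangent space at `p` of the regular level set of `F` through `p`: the vectors of
`T_p(S^n × S^n)` that are orthogonal to `∇̄ F`. -/
def levelTangent (F : Amb n → ℝ) (p : Amb n) : Submodule ℝ (Amb n) :=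
  tangent p ⊓ (ℝ ∙ grad F p)ᗮ

/-- `B` is the second fundamental form at `p`, with respect to the unit normal `N`, of the level set
`M = {F = c}` in `S^n × S^n`: `B(u, V_p) = ⟨∇̄_u V, N⟩` for all `u ∈ T_pM` and all smooth local vector
fields `V` that are tangent to `M` along `M`. -/
def IsSecondFundamentalForm (F : Amb n → ℝ) (c : ℝ) (p : Amb n)
    (B : levelTangent F p →ₗ[ℝ] levelTangent F p →ₗ[ℝ] ℝ) : Prop :=
  ∀ V : Amb n → Amb n, ContDiffAt ℝ ∞ V p →
    (∀ᶠ q in 𝓝 p, q ∈ levelSet F c → V q ∈ levelTangent F q) →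
    ∀ (u v : levelTangent F p), V p = v →
      B u v = inner ℝ (covDeriv V p u) (unitNormal F p)

/-- The squared norm `∑ᵢⱼ B(fᵢ, fⱼ)²` of a bilinear form, for an orthonormal basis `(fᵢ)`. -/
def formNormSq {W : Submodule ℝ (Amb n)} (B : W →ₗ[ℝ] W →ₗ[ℝ] ℝ) : ℝ :=
  ∑ i, ∑ j, B (stdOrthonormalBasis ℝ W i) (stdOrthonormalBasis ℝ W j) ^ 2

end SphereProd

end

open scoped ContDiff Topology

noncomputable section

namespace SphereProd

variable {n : ℕ}

/-! ### Linear algebra of the tangential projection -/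

/-! Write `H = hess F` and `N` for the unit normal. Differentiating `⟨∇̄F, V⟩ = 0` along `M` gives
`B(u, v) = -⟨H u, v⟩ / |∇̄F|` (`inner_covDeriv_unitNormal`); as every tangent vector extends to a
tangent field, this determines `B`. Since `H` is self-adjoint, `|∇̄F|² ‖B‖²` is the trace of the
square of the compression of `H` to `T_pM`, which is `tr H² - 2|H N|² + ⟨H N, N⟩²`
(`trace_hess_starProjection`). The identity `∇̄|∇̄F|² = 2 H ∇̄F` (`grad_gradSq`) rewrites the last
two terms, and `bochner` supplies `tr H²`.

Everything is computed in flat `ℝ^{2n+2}`: covariant derivatives are Euclidean ones composed with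
`tangProj`, and curvature enters only through the derivative of `tangProj`. Identities valid only on
`S^n × S^n` or on `M` are differentiated in tangent directions by Lagrange multipliers, without
charts. -/

/-- The projection `(x, y) ↦ (x, 0)`. -/
def fstL : Amb n →L[ℝ] Amb n :=
  LinearMap.toContinuousLinearMap
    { toFun := fun p => pair (fst p) 0
      map_add' := fun p q => by ext (i | i) <;> simp [pair, fst]
      map_smul' := fun r p => by ext (i | i) <;> simp [pair, fst] }

/-- The projection `(x, y) ↦ (0, y)`. -/
def sndL : Amb n →L[ℝ] Amb n :=
  LinearMap.toContinuousLinearMap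
    { toFun := fun p => pair 0 (snd p)
      map_add' := fun p q => by ext (i | i) <;> simp [pair, snd]
      map_smul' := fun r p => by ext (i | i) <;> simp [pair, snd] }

theorem fstL_apply (p : Amb n) : fstL p = pair (fst p) 0 := rfl

theorem sndL_apply (p : Amb n) : sndL p = pair 0 (snd p) := rfl

@[simp] theorem fstL_fstL (p : Amb n) : fstL (fstL p) = fstL p := rfl

@[simp] theorem sndL_sndL (p : Amb n) : sndL (sndL p) = sndL p := rfl

@[simp] theorem fstL_sndL (p : Amb n) : fstL (sndL p) = 0 := by
  ext (i | i) <;> simp [fstL_apply, sndL_apply, pair, fst]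

@[simp] theorem sndL_fstL (p : Amb n) : sndL (fstL p) = 0 := by
  ext (i | i) <;> simp [fstL_apply, sndL_apply, pair, snd]

theorem fstL_add_sndL (p : Amb n) : fstL p + sndL p = p := by
  ext (i | i) <;> simp [fstL_apply, sndL_apply, pair, fst, snd]

@[simp] theorem inner_fstL_left (p q : Amb n) : inner ℝ (fstL p) q = inner ℝ p (fstL q) := by
  simp [inner_eq, fstL_apply]

@[simp] theorem inner_sndL_left (p q : Amb n) : inner ℝ (sndL p) q = inner ℝ p (sndL q) := by
  simp [inner_eq, sndL_apply]

theorem tangProj_apply (p v : Amb n) :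
    tangProj p v = v - inner ℝ p (fstL v) • fstL p - inner ℝ p (sndL v) • sndL p := by
  simp only [← inner_fstL_left, ← inner_sndL_left]
  simp [tangProj, fstL_apply, sndL_apply]

theorem inner_self_fstL {p : Amb n} (hp : p ∈ sphereProd n) : inner ℝ p (fstL p) = 1 := by
  simp [inner_eq, fstL_apply, hp.1]

theorem inner_self_sndL {p : Amb n} (hp : p ∈ sphereProd n) : inner ℝ p (sndL p) = 1 := by
  simp [inner_eq, sndL_apply, hp.2]

theorem mem_tangent_iff {p v : Amb n} :
    v ∈ tangent p ↔ inner ℝ p (fstL v) = 0 ∧ inner ℝ p (sndL v) = 0 := by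
  simp [tangent, inner_eq, fstL_apply, sndL_apply]

theorem tangProj_of_mem {p v : Amb n} (hv : v ∈ tangent p) : tangProj p v = v := by
  rw [mem_tangent_iff] at hv
  simp [tangProj_apply, hv.1, hv.2]

theorem tangProj_mem {p : Amb n} (hp : p ∈ sphereProd n) (v : Amb n) :
    tangProj p v ∈ tangent p := by
  simp [mem_tangent_iff, tangProj_apply, inner_sub_right, inner_smul_right,
    inner_self_fstL hp, inner_self_sndL hp]

theorem inner_tangProj_left (p v w : Amb n) :
    inner ℝ (tangProj p v) w = inner ℝ v (tangProj p w) := by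
  simp only [tangProj_apply, inner_sub_left, inner_sub_right, inner_smul_left, inner_smul_right,
    inner_fstL_left, inner_sndL_left]
  rw [← inner_fstL_left v p, ← inner_sndL_left v p, real_inner_comm p (fstL v),
    real_inner_comm p (sndL v)]
  simp [mul_comm]

theorem tangProj_fstL_of_mem {p v : Amb n} (hv : v ∈ tangent p) :
    tangProj p (fstL v) = fstL v := by
  rw [mem_tangent_iff] at hv
  simp [tangProj_apply, hv.1]

theorem tangProj_sndL_of_mem {p v : Amb n} (hv : v ∈ tangent p) :
    tangProj p (sndL v) = sndL v := by
  rw [mem_tangent_iff] at hv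
  simp [tangProj_apply, hv.2]

theorem tangProj_fstL_self {p : Amb n} (hp : p ∈ sphereProd n) : tangProj p (fstL p) = 0 := by
  simp [tangProj_apply, inner_self_fstL hp]

theorem tangProj_sndL_self {p : Amb n} (hp : p ∈ sphereProd n) : tangProj p (sndL p) = 0 := by
  simp [tangProj_apply, inner_self_sndL hp]

theorem contDiff_tangProj : ContDiff ℝ ∞ (tangProj : Amb n → Amb n →L[ℝ] Amb n) := by
  rw [contDiff_clm_apply_iff]
  intro v
  simp only [tangProj_apply]
  have h1 : ContDiff ℝ ∞ fun p : Amb n => inner ℝ p (fstL v) := contDiff_id.inner ℝ contDiff_const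
  have h2 : ContDiff ℝ ∞ fun p : Amb n => inner ℝ p (sndL v) := contDiff_id.inner ℝ contDiff_const
  fun_prop

theorem hasFDerivAt_tangProj (p : Amb n) :
    HasFDerivAt tangProj (fderiv ℝ tangProj p) p :=
  (contDiff_tangProj.differentiable (by simp)).differentiableAt.hasFDerivAt

theorem fderiv_tangProj_apply (p u v : Amb n) :
    fderiv ℝ tangProj p u v = - (inner ℝ u (fstL v) • fstL p + inner ℝ p (fstL v) • fstL u
      + (inner ℝ u (sndL v) • sndL p + inner ℝ p (sndL v) • sndL u)) := by
  have h1 := (hasFDerivAt_tangProj p).clm_apply (hasFDerivAt_const v p)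
  have h2 := ((hasFDerivAt_const v p).sub
      (((hasFDerivAt_id p).inner ℝ (hasFDerivAt_const (fstL v) p)).smul fstL.hasFDerivAt)).sub
      (((hasFDerivAt_id p).inner ℝ (hasFDerivAt_const (sndL v) p)).smul sndL.hasFDerivAt)
  simp only [tangProj_apply] at h1
  have h := congrArg (fun f => f u) (h1.unique h2)
  simp at h
  rw [h]
  abel

/-- On tangent vectors this derivative is the second fundamental form of `S^n × S^n` in `ℝ^{2n+2}`,
hence symmetric. -/
theorem fderiv_tangProj_comm {p u v : Amb n} (hu : u ∈ tangent p) (hv : v ∈ tangent p) :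
    fderiv ℝ tangProj p u v = fderiv ℝ tangProj p v u := by
  rw [mem_tangent_iff] at hu hv
  have h1 : inner ℝ v (fstL u) = inner ℝ u (fstL v) := by
    rw [real_inner_comm, inner_fstL_left]
  have h2 : inner ℝ v (sndL u) = inner ℝ u (sndL v) := by
    rw [real_inner_comm, inner_sndL_left]
  simp [fderiv_tangProj_apply, hu.1, hu.2, hv.1, hv.2, h1, h2]

/-- The Weingarten map: only the normal components of `z` contribute. -/
theorem tangProj_fderiv_tangProj {p u : Amb n} (hp : p ∈ sphereProd n) (hu : u ∈ tangent p)
    (z : Amb n) :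
    tangProj p (fderiv ℝ tangProj p u z)
      = - (inner ℝ p (fstL z) • fstL u + inner ℝ p (sndL z) • sndL u) := by
  simp [fderiv_tangProj_apply, tangProj_fstL_self hp, tangProj_sndL_self hp,
    tangProj_fstL_of_mem hu, tangProj_sndL_of_mem hu]

theorem trace_fstL :
    LinearMap.trace ℝ (Amb n) (fstL : Amb n →L[ℝ] Amb n).toLinearMap = n + 1 := by
  rw [LinearMap.trace_eq_sum_inner _ (EuclideanSpace.basisFun (Fin (n + 1) ⊕ Fin (n + 1)) ℝ)]
  simp [fstL_apply, pair, fst, PiLp.inner_apply]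

theorem trace_sndL :
    LinearMap.trace ℝ (Amb n) (sndL : Amb n →L[ℝ] Amb n).toLinearMap = n + 1 := by
  rw [LinearMap.trace_eq_sum_inner _ (EuclideanSpace.basisFun (Fin (n + 1) ⊕ Fin (n + 1)) ℝ)]
  simp [sndL_apply, pair, snd, PiLp.inner_apply]

/-- Of the `n + 1` directions of the first factor, the projection removes the radial one. -/
theorem trace_fstL_tangProj {p : Amb n} (hp : p ∈ sphereProd n) :
    LinearMap.trace ℝ (Amb n) (fstL ∘L tangProj p).toLinearMap = n := by
  have : (fstL ∘L tangProj p).toLinearMap = (fstL : Amb n →L[ℝ] Amb n).toLinearMap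
      - (InnerProductSpace.rankOne ℝ (fstL p) (fstL p)).toLinearMap := by
    ext1 v
    simp [tangProj_apply]
  rw [this, map_sub, trace_fstL, InnerProductSpace.trace_rankOne]
  rw [inner_fstL_left, fstL_fstL, inner_self_fstL hp]
  ring

theorem trace_sndL_tangProj {p : Amb n} (hp : p ∈ sphereProd n) :
    LinearMap.trace ℝ (Amb n) (sndL ∘L tangProj p).toLinearMap = n := by
  have : (sndL ∘L tangProj p).toLinearMap = (sndL : Amb n →L[ℝ] Amb n).toLinearMap
      - (InnerProductSpace.rankOne ℝ (sndL p) (sndL p)).toLinearMap := by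
    ext1 v
    simp [tangProj_apply]
  rw [this, map_sub, trace_sndL, InnerProductSpace.trace_rankOne]
  rw [inner_sndL_left, sndL_sndL, inner_self_sndL hp]
  ring

/-! ### Functions vanishing on a regular level set -/

/-- If `φ` vanishes on the common level set of functions with independent differentials, then its
differential vanishes on the common kernel of these differentials. -/
theorem apply_eq_zero_of_eventually_eq_zero_on_levelSet {E ι : Type*} [NormedAddCommGroup E]
    [NormedSpace ℝ E] [CompleteSpace E] [Fintype ι] {f : ι → E → ℝ} {f' : ι → StrongDual ℝ E}
    {φ : E → ℝ} {φ' : StrongDual ℝ E} {x₀ : E} (hf : ∀ i, HasStrictFDerivAt (f i) (f' i) x₀)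
    (hli : LinearIndependent ℝ f') (hφ : HasStrictFDerivAt φ φ' x₀)
    (h0 : ∀ᶠ x in 𝓝 x₀, (∀ i, f i x = f i x₀) → φ x = 0) {u : E} (hu : ∀ i, f' i u = 0) :
    φ' u = 0 := by
  have hx₀ : φ x₀ = 0 := h0.self_of_nhds fun _ => rfl
  -- Being constant on the level set, `φ` has a trivial constrained extremum at `x₀`, so Lagrange
  -- multipliers exist.
  have hext : IsLocalExtrOn φ {x | ∀ i, f i x = f i x₀} x₀ := by
    left
    filter_upwards [mem_nhdsWithin_of_mem_nhds h0, self_mem_nhdsWithin] with x hx hx'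
    rw [hx₀, hx hx']
  obtain ⟨Λ, Λ₀, hne, hsum⟩ := hext.exists_multipliers_of_hasStrictFDerivAt hf hφ
  -- Otherwise the multipliers would be a nontrivial relation among the independent `f' i`.
  have hΛ₀ : Λ₀ ≠ 0 := by
    rintro rfl
    apply hne
    rw [zero_smul, add_zero] at hsum
    have := Fintype.linearIndependent_iff.1 hli Λ hsum
    simp [Prod.ext_iff, funext_iff, this]
  have h := congrArg (fun g : StrongDual ℝ E => g u) hsum
  simpa [hu, hΛ₀] using h

theorem mem_sphereProd_iff {p : Amb n} :
    p ∈ sphereProd n ↔ inner ℝ p (fstL p) = 1 ∧ inner ℝ p (sndL p) = 1 := by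
  simp [sphereProd, inner_eq, fstL_apply, sndL_apply, pow_eq_one_iff_of_nonneg]

theorem hasStrictFDerivAt_inner_fstL (p : Amb n) :
    HasStrictFDerivAt (fun q : Amb n => inner ℝ q (fstL q))
      ((2 : ℝ) • innerSL ℝ (fstL p)) p := by
  refine ((hasStrictFDerivAt_id p).inner ℝ fstL.hasStrictFDerivAt).congr_fderiv ?_
  refine ContinuousLinearMap.ext fun u => ?_
  simp [two_mul, ← inner_fstL_left u, real_inner_comm p]

theorem hasStrictFDerivAt_inner_sndL (p : Amb n) :
    HasStrictFDerivAt (fun q : Amb n => inner ℝ q (sndL q))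
      ((2 : ℝ) • innerSL ℝ (sndL p)) p := by
  refine ((hasStrictFDerivAt_id p).inner ℝ sndL.hasStrictFDerivAt).congr_fderiv ?_
  refine ContinuousLinearMap.ext fun u => ?_
  simp [two_mul, ← inner_sndL_left u, real_inner_comm p]

theorem fderiv_apply_eq_zero_of_sphereProd {φ : Amb n → ℝ} {p u : Amb n}
    (hφ : ContDiffAt ℝ 1 φ p) (hp : p ∈ sphereProd n)
    (h0 : ∀ᶠ q in 𝓝 p, q ∈ sphereProd n → φ q = 0) (hu : u ∈ tangent p) :
    fderiv ℝ φ p u = 0 := by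
  rw [mem_tangent_iff] at hu
  have hp' := mem_sphereProd_iff.1 hp
  refine apply_eq_zero_of_eventually_eq_zero_on_levelSet
    (f := ![fun q => inner ℝ q (fstL q), fun q => inner ℝ q (sndL q)])
    (f' := ![(2 : ℝ) • innerSL ℝ (fstL p), (2 : ℝ) • innerSL ℝ (sndL p)]) ?_ ?_
    (hφ.hasStrictFDerivAt one_ne_zero) ?_ ?_
  · simp [Fin.forall_fin_two, hasStrictFDerivAt_inner_fstL, hasStrictFDerivAt_inner_sndL]
  · rw [Fintype.linearIndependent_iff]
    intro c hc
    rw [Fin.sum_univ_two] at hc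
    have h1 := congrArg (fun g : StrongDual ℝ (Amb n) => g (fstL p)) hc
    have h2 := congrArg (fun g : StrongDual ℝ (Amb n) => g (sndL p)) hc
    simp only [Matrix.cons_val_zero, Matrix.cons_val_one, _root_.add_apply,
      _root_.smul_apply, innerSL_apply_apply, inner_fstL_left, inner_sndL_left,
      fstL_fstL, fstL_sndL, sndL_sndL, sndL_fstL, hp'.1, hp'.2, inner_zero_right, smul_eq_mul,
      _root_.zero_apply] at h1 h2
    simp [Fin.forall_fin_two]
    constructor <;> linarith
  · filter_upwards [h0] with q hq h
    simp only [Fin.forall_fin_two, Matrix.cons_val_zero, Matrix.cons_val_one, hp'.1, hp'.2] at h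
    exact hq (mem_sphereProd_iff.2 h)
  · simp [Fin.forall_fin_two, hu.1, hu.2]

theorem fderiv_apply_eq_of_eq_on_sphereProd {f g : Amb n → Amb n} {p u : Amb n}
    (hf : ContDiffAt ℝ 1 f p) (hg : ContDiffAt ℝ 1 g p) (hp : p ∈ sphereProd n)
    (hfg : ∀ᶠ q in 𝓝 p, q ∈ sphereProd n → f q = g q) (hu : u ∈ tangent p) :
    fderiv ℝ f p u = fderiv ℝ g p u := by
  refine ext_inner_left ℝ fun w => ?_
  have hf' := (hasFDerivAt_const w p).inner ℝ (hf.differentiableAt one_ne_zero).hasFDerivAt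
  have hg' := (hasFDerivAt_const w p).inner ℝ (hg.differentiableAt one_ne_zero).hasFDerivAt
  have h := fderiv_apply_eq_zero_of_sphereProd
    ((contDiffAt_const.inner ℝ hf).sub (contDiffAt_const.inner ℝ hg)) hp
    (φ := fun q => inner ℝ w (f q) - inner ℝ w (g q))
    (by filter_upwards [hfg] with q h hq; rw [h hq, sub_self]) hu
  have h2 := (hf'.sub hg').fderiv
  change fderiv ℝ (fun q => inner ℝ w (f q) - inner ℝ w (g q)) p = _ at h2
  rw [h2] at h
  simpa [sub_eq_zero] using h

theorem two_le_infty : minSmoothness ℝ 2 ≤ (∞ : WithTop ℕ∞) := by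
  rw [minSmoothness_of_isRCLikeNormedField]
  exact WithTop.coe_le_coe.2 (le_top : (2 : ℕ∞) ≤ ⊤)

/-! ### Gradient and Hessian -/

/-- The Hessian operator `v ↦ ∇̄_v ∇̄ F`, extended by zero to the normal directions. -/
def hess (F : Amb n → ℝ) (p : Amb n) : Amb n →L[ℝ] Amb n :=
  tangProj p ∘L fderiv ℝ (grad F) p ∘L tangProj p

theorem laplacian_eq_trace_hess (F : Amb n → ℝ) (p : Amb n) :
    laplacian F p = LinearMap.trace ℝ (Amb n) (hess F p).toLinearMap := rfl

theorem hess_apply (F : Amb n → ℝ) (p v : Amb n) :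
    hess F p v = tangProj p (fderiv ℝ (grad F) p (tangProj p v)) := rfl

theorem grad_mem {p : Amb n} (hp : p ∈ sphereProd n) (F : Amb n → ℝ) : grad F p ∈ tangent p :=
  tangProj_mem hp _

theorem hess_mem {p : Amb n} (hp : p ∈ sphereProd n) (F : Amb n → ℝ) (v : Amb n) :
    hess F p v ∈ tangent p :=
  tangProj_mem hp _

theorem inner_grad {p u : Amb n} (hu : u ∈ tangent p) (F : Amb n → ℝ) :
    inner ℝ (grad F p) u = fderiv ℝ F p u := by
  rw [grad, inner_tangProj_left, tangProj_of_mem hu, inner_gradient_left]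

section

variable {F : Amb n → ℝ} {p : Amb n}

theorem contDiffAt_gradient (hF : ContDiffAt ℝ ∞ F p) : ContDiffAt ℝ ∞ (gradient F) p :=
  (InnerProductSpace.toDual ℝ (Amb n)).symm.contDiff.contDiffAt.comp p
    (hF.fderiv_right (m := ∞) (by simp))

theorem contDiffAt_grad (hF : ContDiffAt ℝ ∞ F p) : ContDiffAt ℝ ∞ (grad F) p :=
  contDiff_tangProj.contDiffAt.clm_apply (contDiffAt_gradient hF)

theorem contDiffAt_gradSq (hF : ContDiffAt ℝ ∞ F p) : ContDiffAt ℝ ∞ (gradSq F) p :=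
  (contDiffAt_grad hF).norm_sq ℝ

theorem contDiffAt_fderiv_grad (hF : ContDiffAt ℝ ∞ F p) :
    ContDiffAt ℝ ∞ (fderiv ℝ (grad F)) p :=
  (contDiffAt_grad hF).fderiv_right (by simp)

theorem contDiffAt_hess (hF : ContDiffAt ℝ ∞ F p) : ContDiffAt ℝ ∞ (hess F) p :=
  contDiff_tangProj.contDiffAt.clm_comp
    ((contDiffAt_fderiv_grad hF).clm_comp contDiff_tangProj.contDiffAt)

theorem inner_fderiv_gradient (hF : ContDiffAt ℝ ∞ F p) (u v : Amb n) :
    inner ℝ (fderiv ℝ (gradient F) p u) v = fderiv ℝ (fderiv ℝ F) p u v := by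
  have h : HasFDerivAt (gradient F) _ p :=
    (InnerProductSpace.toDual ℝ (Amb n)).symm.toContinuousLinearEquiv.hasFDerivAt.comp p
      ((hF.fderiv_right (m := ∞) (by simp)).differentiableAt (by simp)).hasFDerivAt
  rw [h.fderiv]
  exact InnerProductSpace.toDual_symm_apply

/-- The Euclidean Hessian corrected by the derivative of `tangProj`; the terms of that derivative
along `fstL p` and `sndL p` are orthogonal to the tangent vector `v`. -/
theorem inner_fderiv_grad (hF : ContDiffAt ℝ ∞ F p) (u : Amb n) {v : Amb n} (hv : v ∈ tangent p) :
    inner ℝ (fderiv ℝ (grad F) p u) v = fderiv ℝ (fderiv ℝ F) p u v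
      - (inner ℝ p (fstL (gradient F p)) * inner ℝ u (fstL v)
        + inner ℝ p (sndL (gradient F p)) * inner ℝ u (sndL v)) := by
  have h := (hasFDerivAt_tangProj p).clm_apply
    ((contDiffAt_gradient hF).differentiableAt (by simp)).hasFDerivAt
  change HasFDerivAt (grad F) _ p at h
  rw [h.fderiv]
  rw [← inner_fderiv_gradient hF]
  have hv' := mem_tangent_iff.1 hv
  simp only [_root_.add_apply, ContinuousLinearMap.comp_apply,
    ContinuousLinearMap.flip_apply, inner_add_left, inner_tangProj_left, tangProj_of_mem hv,
    fderiv_tangProj_apply, inner_neg_left, inner_smul_left, inner_fstL_left, inner_sndL_left,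
    hv'.1, hv'.2]
  simp
  ring

/-- In `inner_fderiv_grad`, the Euclidean Hessian is symmetric by Schwarz and the correction because
`fstL` and `sndL` are self-adjoint. -/
theorem inner_hess_left (hF : ContDiffAt ℝ ∞ F p) (hp : p ∈ sphereProd n) (v w : Amb n) :
    inner ℝ (hess F p v) w = inner ℝ v (hess F p w) := by
  rw [real_inner_comm (hess F p w), hess_apply, hess_apply, inner_tangProj_left,
    inner_tangProj_left, inner_fderiv_grad hF _ (tangProj_mem hp w),
    inner_fderiv_grad hF _ (tangProj_mem hp v),
    hF.isSymmSndFDerivAt two_le_infty (tangProj p v), ← inner_fstL_left (tangProj p w),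
    ← inner_sndL_left (tangProj p w), real_inner_comm (tangProj p v) (fstL _),
    real_inner_comm (tangProj p v) (sndL _)]

theorem tangProj_hess (hp : p ∈ sphereProd n) (v : Amb n) :
    tangProj p (hess F p v) = hess F p v :=
  tangProj_of_mem (hess_mem hp F v)

theorem hess_of_mem {v : Amb n} (hv : v ∈ tangent p) :
    hess F p v = tangProj p (fderiv ℝ (grad F) p v) := by
  rw [hess_apply, tangProj_of_mem hv]

theorem grad_gradSq (hF : ContDiffAt ℝ ∞ F p) (hp : p ∈ sphereProd n) :
    grad (gradSq F) p = (2 : ℝ) • hess F p (grad F p) := by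
  have h := ((contDiffAt_grad hF).differentiableAt (by simp)).hasFDerivAt.norm_sq
  change HasFDerivAt (gradSq F) _ p at h
  refine ext_inner_right ℝ fun w => ?_
  rw [grad, inner_tangProj_left, inner_gradient_left, h.fderiv, inner_smul_left,
    inner_hess_left hF hp, hess_apply, ← inner_tangProj_left, tangProj_of_mem (grad_mem hp F)]
  simp

end

/-! ### The Codazzi equation and the Bochner formula -/

section

variable {F : Amb n → ℝ} {p : Amb n}

theorem hess_tangProj (hp : p ∈ sphereProd n) (v : Amb n) :
    hess F p (tangProj p v) = hess F p v := by
  rw [hess_apply, hess_apply, tangProj_of_mem (tangProj_mem hp v)]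

theorem fderiv_hess (hF : ContDiffAt ℝ ∞ F p) (u : Amb n) :
    fderiv ℝ (hess F) p u =
      fderiv ℝ tangProj p u ∘L fderiv ℝ (grad F) p ∘L tangProj p
        + tangProj p ∘L fderiv ℝ (fderiv ℝ (grad F)) p u ∘L tangProj p
        + tangProj p ∘L fderiv ℝ (grad F) p ∘L fderiv ℝ tangProj p u := by
  have h := (hasFDerivAt_tangProj p).clm_comp
    (((contDiffAt_fderiv_grad hF).differentiableAt (by simp)).hasFDerivAt.clm_comp
      (hasFDerivAt_tangProj p))
  change HasFDerivAt (hess F) _ p at h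
  rw [h.fderiv]
  ext1 v
  simp
  abel

/-- Differentiate `⟨x, fstL ∇̄F⟩ = 0`, which holds on `S^n × S^n` by tangency of `∇̄F`. -/
theorem inner_fstL_fderiv_grad (hF : ContDiffAt ℝ ∞ F p) (hp : p ∈ sphereProd n) {v : Amb n}
    (hv : v ∈ tangent p) :
    inner ℝ p (fstL (fderiv ℝ (grad F) p v)) = - inner ℝ v (fstL (grad F p)) := by
  have hG := contDiffAt_grad hF
  have h := (hasFDerivAt_id p).inner ℝ
    (fstL.hasFDerivAt.comp p (hG.differentiableAt (by simp)).hasFDerivAt)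
  have h0 := fderiv_apply_eq_zero_of_sphereProd (φ := fun q => inner ℝ q (fstL (grad F q)))
    ((contDiffAt_id.inner ℝ (fstL.contDiff.contDiffAt.comp p hG)).of_le (by simp)) hp
    (.of_forall fun q hq => (mem_tangent_iff.1 (grad_mem hq F)).1) hv
  change HasFDerivAt (fun q => inner ℝ q (fstL (grad F q))) _ p at h
  rw [h.fderiv] at h0
  simp at h0
  linarith

theorem inner_sndL_fderiv_grad (hF : ContDiffAt ℝ ∞ F p) (hp : p ∈ sphereProd n) {v : Amb n}
    (hv : v ∈ tangent p) :
    inner ℝ p (sndL (fderiv ℝ (grad F) p v)) = - inner ℝ v (sndL (grad F p)) := by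
  have hG := contDiffAt_grad hF
  have h := (hasFDerivAt_id p).inner ℝ
    (sndL.hasFDerivAt.comp p (hG.differentiableAt (by simp)).hasFDerivAt)
  have h0 := fderiv_apply_eq_zero_of_sphereProd (φ := fun q => inner ℝ q (sndL (grad F q)))
    ((contDiffAt_id.inner ℝ (sndL.contDiff.contDiffAt.comp p hG)).of_le (by simp)) hp
    (.of_forall fun q hq => (mem_tangent_iff.1 (grad_mem hq F)).2) hv
  change HasFDerivAt (fun q => inner ℝ q (sndL (grad F q))) _ p at h
  rw [h.fderiv] at h0
  simp at h0
  linarith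

/-- The Weingarten map meets the normal part of `D_v ∇̄F` in the first two terms; these alone are
not symmetric in `u` and `v`, and their antisymmetrization is the curvature. -/
theorem tangProj_fderiv_hess_of_mem (hF : ContDiffAt ℝ ∞ F p) (hp : p ∈ sphereProd n)
    {u v : Amb n} (hu : u ∈ tangent p) (hv : v ∈ tangent p) :
    tangProj p (fderiv ℝ (hess F) p u v) =
      inner ℝ v (fstL (grad F p)) • fstL u + inner ℝ v (sndL (grad F p)) • sndL u
        + (tangProj p (fderiv ℝ (fderiv ℝ (grad F)) p u v)
          + tangProj p (fderiv ℝ (grad F) p (fderiv ℝ tangProj p u v))) := by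
  rw [fderiv_hess hF]
  simp only [_root_.add_apply, ContinuousLinearMap.comp_apply, map_add, tangProj_of_mem hv,
    tangProj_of_mem (tangProj_mem hp _), tangProj_fderiv_tangProj hp hu,
    inner_fstL_fderiv_grad hF hp hv, inner_sndL_fderiv_grad hF hp hv]
  module

/-- The Codazzi equation: the Hessian of `F` is symmetric up to the curvature of `S^n × S^n`. -/
theorem tangProj_fderiv_hess_comm (hF : ContDiffAt ℝ ∞ F p) (hp : p ∈ sphereProd n)
    {u v : Amb n} (hu : u ∈ tangent p) (hv : v ∈ tangent p) :
    tangProj p (fderiv ℝ (hess F) p u v) = tangProj p (fderiv ℝ (hess F) p v u)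
      + (inner ℝ v (fstL (grad F p)) • fstL u - inner ℝ u (fstL (grad F p)) • fstL v)
      + (inner ℝ v (sndL (grad F p)) • sndL u - inner ℝ u (sndL (grad F p)) • sndL v) := by
  rw [tangProj_fderiv_hess_of_mem hF hp hu hv, tangProj_fderiv_hess_of_mem hF hp hv hu,
    fderiv_tangProj_comm hu hv,
    (contDiffAt_grad hF).isSymmSndFDerivAt two_le_infty u v]
  module

theorem tangProj_comp_tangProj (hp : p ∈ sphereProd n) :
    tangProj p ∘L tangProj p = tangProj p :=
  ContinuousLinearMap.ext fun v => tangProj_of_mem (tangProj_mem hp v)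

theorem trace_comp_comm (A B : Amb n →L[ℝ] Amb n) :
    LinearMap.trace ℝ (Amb n) (A ∘L B).toLinearMap
      = LinearMap.trace ℝ (Amb n) (B ∘L A).toLinearMap :=
  LinearMap.trace_comp_comm' _ _

/-- Each Leibniz term of `fderiv_hess` already has `tangProj p` at one end, so cyclicity of the
trace and idempotence absorb the outer projections. -/
theorem trace_tangProj_fderiv_hess (hF : ContDiffAt ℝ ∞ F p) (hp : p ∈ sphereProd n) (u : Amb n) :
    LinearMap.trace ℝ (Amb n)
        (tangProj p ∘L fderiv ℝ (hess F) p u ∘L tangProj p).toLinearMap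
      = LinearMap.trace ℝ (Amb n) (fderiv ℝ (hess F) p u).toLinearMap := by
  rw [trace_comp_comm, ContinuousLinearMap.comp_assoc, tangProj_comp_tangProj hp, fderiv_hess hF]
  simp only [ContinuousLinearMap.add_comp, ContinuousLinearMap.comp_assoc,
    tangProj_comp_tangProj hp, ContinuousLinearMap.toLinearMap_add, map_add]
  congr 1
  rw [trace_comp_comm]
  simp only [ContinuousLinearMap.comp_assoc, tangProj_comp_tangProj hp]
  rw [← ContinuousLinearMap.comp_assoc, trace_comp_comm]

/-- The trace of endomorphisms of `ℝ^{2n+2}` as a continuous linear form. -/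
def traceL : (Amb n →L[ℝ] Amb n) →L[ℝ] ℝ :=
  LinearMap.toContinuousLinearMap (LinearMap.trace ℝ (Amb n) ∘ₗ ContinuousLinearMap.coeLM ℝ)

theorem fderiv_laplacian (hF : ContDiffAt ℝ ∞ F p) (u : Amb n) :
    fderiv ℝ (laplacian F) p u
      = LinearMap.trace ℝ (Amb n) (fderiv ℝ (hess F) p u).toLinearMap := by
  have h := traceL.hasFDerivAt.comp p
    ((contDiffAt_hess hF).differentiableAt (by simp)).hasFDerivAt
  change HasFDerivAt (laplacian F) _ p at h
  rw [h.fderiv]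
  rfl

theorem hess_gradSq (hF : ∀ᶠ q in 𝓝 p, ContDiffAt ℝ ∞ F q) (hp : p ∈ sphereProd n) :
    hess (gradSq F) p = (2 : ℝ) • (tangProj p ∘L (fderiv ℝ (hess F) p).flip (grad F p) ∘L tangProj p
      + hess F p ∘L hess F p) := by
  have hFp := hF.self_of_nhds
  have hH := contDiffAt_hess hFp
  have hG := contDiffAt_grad hFp
  have h := (((hH.differentiableAt (by simp)).hasFDerivAt.clm_apply
    (hG.differentiableAt (by simp)).hasFDerivAt).const_smul (2 : ℝ)).fderiv
  have hg : ContDiffAt ℝ ∞ (fun q => (2 : ℝ) • hess F q (grad F q)) p :=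
    (hH.clm_apply hG).const_smul (2 : ℝ)
  ext1 v
  -- `grad_gradSq` holds only on `S^n × S^n`, so the two sides are compared along the tangent vector
  -- `tangProj p v`.
  rw [hess_apply, fderiv_apply_eq_of_eq_on_sphereProd
    (g := fun q => (2 : ℝ) • hess F q (grad F q))
    ((contDiffAt_grad (contDiffAt_gradSq hFp)).of_le (by simp))
    (hg.of_le (by simp)) hp
    (by filter_upwards [hF] with q hq hq' using grad_gradSq hq hq') (tangProj_mem hp v)]
  change fderiv ℝ (fun q => (2 : ℝ) • hess F q (grad F q)) p = _ at h
  rw [h]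
  simp only [_root_.add_apply, _root_.smul_apply, ContinuousLinearMap.comp_apply, map_add, map_smul,
    tangProj_hess hp, ContinuousLinearMap.flip_apply]
  rw [← hess_tangProj hp (fderiv ℝ (grad F) p _), ← hess_apply F p v,
    add_comm (hess F p _)]

/-- The Bochner formula on `S^n × S^n`, whose Ricci tensor is `n - 1` times the metric. -/
theorem bochner (hF : ∀ᶠ q in 𝓝 p, ContDiffAt ℝ ∞ F q) (hp : p ∈ sphereProd n) :
    1 / 2 * laplacian (gradSq F) p =
      LinearMap.trace ℝ (Amb n) (hess F p ∘L hess F p).toLinearMap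
        + inner ℝ (grad F p) (grad (laplacian F) p) + ((n : ℝ) - 1) * ‖grad F p‖ ^ 2 := by
  have hFp := hF.self_of_nhds
  have hG := grad_mem hp F
  -- Codazzi moves the differentiation onto the direction `∇̄F`, where the trace becomes the
  -- derivative of `Δ̄F`. Each factor's curvature term has trace `(n - 1)` times the squared norm of
  -- that component of `∇̄F`.
  have key : tangProj p ∘L (fderiv ℝ (hess F) p).flip (grad F p) ∘L tangProj p
      = tangProj p ∘L fderiv ℝ (hess F) p (grad F p) ∘L tangProj p
        + (inner ℝ (grad F p) (fstL (grad F p)) • (fstL ∘L tangProj p)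
          - InnerProductSpace.rankOne ℝ (fstL (grad F p)) (fstL (grad F p)))
        + (inner ℝ (grad F p) (sndL (grad F p)) • (sndL ∘L tangProj p)
          - InnerProductSpace.rankOne ℝ (sndL (grad F p)) (sndL (grad F p))) := by
    ext1 v
    simp only [ContinuousLinearMap.comp_apply, ContinuousLinearMap.flip_apply,
      tangProj_fderiv_hess_comm hFp hp (tangProj_mem hp v) hG, _root_.add_apply, _root_.sub_apply,
      _root_.smul_apply, InnerProductSpace.rankOne_apply, inner_tangProj_left,
      tangProj_fstL_of_mem hG, tangProj_sndL_of_mem hG]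
    rw [real_inner_comm v (fstL _), real_inner_comm v (sndL _)]
  have hnorm : inner ℝ (grad F p) (fstL (grad F p)) + inner ℝ (grad F p) (sndL (grad F p))
      = ‖grad F p‖ ^ 2 := by
    rw [← inner_add_right, fstL_add_sndL, real_inner_self_eq_norm_sq]
  rw [laplacian_eq_trace_hess, hess_gradSq hF hp, key,
    real_inner_comm (grad (laplacian F) p) (grad F p), inner_grad hG,
    fderiv_laplacian hFp, ← trace_tangProj_fderiv_hess hFp hp, ← hnorm]
  simp only [ContinuousLinearMap.toLinearMap_add, ContinuousLinearMap.toLinearMap_sub,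
    ContinuousLinearMap.toLinearMap_smul, map_add, map_sub, map_smul, smul_eq_mul,
    trace_fstL_tangProj hp, trace_sndL_tangProj hp, InnerProductSpace.trace_rankOne,
    inner_fstL_left, inner_sndL_left, fstL_fstL, sndL_sndL]
  ring

end

/-! ### The second fundamental form of a level set -/

/-- The Hilbert–Schmidt norm of the compression of a symmetric operator to a subspace. -/
theorem sum_sq_inner_eq_trace {W : Submodule ℝ (Amb n)} {A : Amb n →L[ℝ] Amb n}
    (hA : ∀ v w, inner ℝ (A v) w = inner ℝ v (A w)) {ι : Type*} [Fintype ι]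
    (b : OrthonormalBasis ι ℝ W) :
    ∑ i, ∑ j, inner ℝ (A (b i)) (b j : Amb n) ^ 2
      = LinearMap.trace ℝ (Amb n)
        ((A ∘L W.starProjection) ∘L (A ∘L W.starProjection)).toLinearMap := by
  -- By Parseval, each row sum is the squared norm of the projection of `A (b i)` to `W`.
  have h1 (i : ι) : ∑ j, inner ℝ (A (b i)) (b j : Amb n) ^ 2
      = inner ℝ (b i) (W.orthogonalProjectionOnto (A (W.starProjection (A (b i))))) := by
    have : ∀ j, inner ℝ (A (b i)) (b j : Amb n)
        = inner ℝ (b j) (W.orthogonalProjectionOnto (A (b i))) := by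
      intro j
      rw [Submodule.inner_orthogonalProjectionOnto_eq_of_mem_left, real_inner_comm]
    simp only [this]
    rw [b.sum_sq_inner_right, Submodule.inner_orthogonalProjectionOnto_eq_of_mem_left, ← hA,
      ← real_inner_self_eq_norm_sq, Submodule.inner_orthogonalProjectionOnto_eq_of_mem_left,
      real_inner_comm]
    rfl
  have h2 := LinearMap.trace_eq_sum_inner
    ((W.orthogonalProjectionOnto ∘L A ∘L W.starProjection ∘L A ∘L W.subtypeL).toLinearMap) b
  simp only [h1]
  refine h2.symm.trans ?_
  rw [ContinuousLinearMap.toLinearMap_comp, LinearMap.trace_comp_comm',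
    ← ContinuousLinearMap.toLinearMap_comp]
  rfl

theorem mem_levelTangent_iff {F : Amb n → ℝ} {p v : Amb n} :
    v ∈ levelTangent F p ↔ v ∈ tangent p ∧ inner ℝ (grad F p) v = 0 := by
  rw [levelTangent, Submodule.mem_inf, Submodule.mem_orthogonal_singleton_iff_inner_right]

section

variable {F : Amb n → ℝ} {c : ℝ} {p : Amb n}

theorem norm_unitNormal (hG : grad F p ≠ 0) : ‖unitNormal F p‖ = 1 := by
  simp [unitNormal, norm_smul, hG]

theorem grad_eq_smul_unitNormal (hG : grad F p ≠ 0) :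
    grad F p = ‖grad F p‖ • unitNormal F p := by
  simp [unitNormal, smul_smul, hG]

theorem unitNormal_mem (hp : p ∈ sphereProd n) (F : Amb n → ℝ) : unitNormal F p ∈ tangent p :=
  (tangent p).smul_mem _ (grad_mem hp F)

theorem tangProj_sub_mem_levelTangent (hp : p ∈ sphereProd n) (hG : grad F p ≠ 0) (v : Amb n) :
    tangProj p v - inner ℝ (unitNormal F p) v • unitNormal F p ∈ levelTangent F p := by
  refine mem_levelTangent_iff.2 ⟨Submodule.sub_mem _ (tangProj_mem hp v)
    (Submodule.smul_mem _ _ (unitNormal_mem hp F)), ?_⟩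
  rw [grad_eq_smul_unitNormal hG, inner_smul_left, inner_sub_right, inner_smul_right,
    real_inner_self_eq_norm_sq, norm_unitNormal hG, ← inner_tangProj_left,
    tangProj_of_mem (unitNormal_mem hp F)]
  simp

theorem inner_unitNormal_of_mem {v : Amb n} (hv : v ∈ levelTangent F p) :
    inner ℝ (unitNormal F p) v = 0 := by
  rw [unitNormal, inner_smul_left, (mem_levelTangent_iff.1 hv).2, mul_zero]

theorem starProjection_levelTangent (hp : p ∈ sphereProd n) (hG : grad F p ≠ 0) :
    (levelTangent F p).starProjection
      = tangProj p - InnerProductSpace.rankOne ℝ (unitNormal F p) (unitNormal F p) := by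
  ext1 v
  apply Submodule.eq_starProjection_of_mem_of_inner_eq_zero
  · exact tangProj_sub_mem_levelTangent hp hG v
  · intro w hw
    simp [inner_sub_left, inner_smul_left, inner_tangProj_left, inner_unitNormal_of_mem hw,
      tangProj_of_mem (mem_levelTangent_iff.1 hw).1]

theorem fderiv_apply_eq_zero_of_levelSet {φ : Amb n → ℝ} {u : Amb n} (hF : ContDiffAt ℝ 1 F p)
    (hφ : ContDiffAt ℝ 1 φ p) (hp : p ∈ levelSet F c) (hG : grad F p ≠ 0)
    (h0 : ∀ᶠ q in 𝓝 p, q ∈ levelSet F c → φ q = 0) (hu : u ∈ levelTangent F p) :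
    fderiv ℝ φ p u = 0 := by
  obtain ⟨hu, hu'⟩ := mem_levelTangent_iff.1 hu
  rw [inner_grad hu] at hu'
  rw [mem_tangent_iff] at hu
  have hp' := mem_sphereProd_iff.1 hp.1
  have hGt := grad_mem hp.1 F
  refine apply_eq_zero_of_eventually_eq_zero_on_levelSet
    (f := ![fun q => inner ℝ q (fstL q), fun q => inner ℝ q (sndL q), F])
    (f' := ![(2 : ℝ) • innerSL ℝ (fstL p), (2 : ℝ) • innerSL ℝ (sndL p), fderiv ℝ F p]) ?_ ?_
    (hφ.hasStrictFDerivAt one_ne_zero) ?_ ?_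
  · intro i
    fin_cases i
    exacts [hasStrictFDerivAt_inner_fstL p, hasStrictFDerivAt_inner_sndL p,
      hF.hasStrictFDerivAt one_ne_zero]
  · rw [Fintype.linearIndependent_iff]
    intro k hk
    rw [Fin.sum_univ_three] at hk
    have h (v : Amb n) := congrArg (fun g : StrongDual ℝ (Amb n) => g v) hk
    simp only [Matrix.cons_val, _root_.add_apply, _root_.smul_apply, innerSL_apply_apply,
      inner_fstL_left, inner_sndL_left, smul_eq_mul, _root_.zero_apply] at h
    -- Tangency of `∇̄F` kills the two sphere constraints, isolating the coefficient of `dF`.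
    have h3 := h (grad F p)
    rw [(mem_tangent_iff.1 hGt).1, (mem_tangent_iff.1 hGt).2, ← inner_grad hGt,
      real_inner_self_eq_norm_sq] at h3
    have hk2 : k 2 = 0 := by simpa [hG] using h3
    have h1 := h (fstL p)
    have h2 := h (sndL p)
    simp [hp'.1, hp'.2, hk2] at h1 h2
    intro i
    fin_cases i
    exacts [h1, h2, hk2]
  · filter_upwards [h0] with q hq h
    have e1 := h 0
    have e2 := h 1
    have e3 := h 2
    simp only [Matrix.cons_val, hp'.1, hp'.2] at e1 e2 e3
    exact hq ⟨mem_sphereProd_iff.2 ⟨e1, e2⟩, e3.trans hp.2⟩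
  · intro i
    fin_cases i
    exacts [by simp [hu.1], by simp [hu.2], hu']

/-- Differentiate `⟨∇̄F, V⟩ = 0` along `M`; the result depends on `V` only through `V p`. -/
theorem inner_covDeriv_unitNormal (hF : ContDiffAt ℝ ∞ F p) (hp : p ∈ levelSet F c)
    (hG : grad F p ≠ 0) {V : Amb n → Amb n} (hV : ContDiffAt ℝ ∞ V p)
    (hVt : ∀ᶠ q in 𝓝 p, q ∈ levelSet F c → V q ∈ levelTangent F q) {u : Amb n}
    (hu : u ∈ levelTangent F p) :
    inner ℝ (covDeriv V p u) (unitNormal F p)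
      = -‖grad F p‖⁻¹ * inner ℝ (hess F p u) (V p) := by
  have hg := contDiffAt_grad hF
  have h0 := fderiv_apply_eq_zero_of_levelSet (φ := fun q => inner ℝ (grad F q) (V q))
    (hF.of_le (by simp)) ((hg.inner ℝ hV).of_le (by simp)) hp hG
    (by filter_upwards [hVt] with q h hq using (mem_levelTangent_iff.1 (h hq)).2) hu
  have h := (hg.differentiableAt (by simp)).hasFDerivAt.inner ℝ
    (hV.differentiableAt (by simp)).hasFDerivAt
  rw [h.fderiv] at h0
  have hVp := (mem_levelTangent_iff.1 (hVt.self_of_nhds hp)).1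
  rw [covDeriv, inner_tangProj_left, tangProj_of_mem (unitNormal_mem hp.1 F), unitNormal,
    inner_smul_right, hess_of_mem (mem_levelTangent_iff.1 hu).1, inner_tangProj_left,
    tangProj_of_mem hVp, real_inner_comm (grad F p)]
  simp at h0
  linear_combination ‖grad F p‖⁻¹ * h0

theorem contDiffAt_unitNormal (hF : ContDiffAt ℝ ∞ F p) (hG : grad F p ≠ 0) :
    ContDiffAt ℝ ∞ (unitNormal F) p :=
  (((contDiffAt_grad hF).norm ℝ hG).inv (norm_ne_zero_iff.2 hG)).smul (contDiffAt_grad hF)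

/-- Tangent vectors of a regular level set extend to tangent vector fields. -/
theorem exists_extension (hF : ContDiffAt ℝ ∞ F p) (hp : p ∈ levelSet F c)
    (hreg : ∀ q ∈ levelSet F c, grad F q ≠ 0) {v : Amb n} (hv : v ∈ levelTangent F p) :
    ∃ V : Amb n → Amb n, ContDiffAt ℝ ∞ V p ∧
      (∀ᶠ q in 𝓝 p, q ∈ levelSet F c → V q ∈ levelTangent F q) ∧ V p = v := by
  have hN := contDiffAt_unitNormal hF (hreg p hp)
  -- Project the constant field `v` onto the tangent space of the level set through `q`.
  refine ⟨fun q => tangProj q v - inner ℝ (unitNormal F q) v • unitNormal F q, ?_, ?_, ?_⟩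
  · exact (contDiff_tangProj.contDiffAt.clm_apply contDiffAt_const).sub
      ((hN.inner ℝ contDiffAt_const).smul hN)
  · exact .of_forall fun q hq => tangProj_sub_mem_levelTangent hq.1 (hreg q hq) v
  · simp only [tangProj_of_mem (mem_levelTangent_iff.1 hv).1, inner_unitNormal_of_mem hv, zero_smul,
      sub_zero]

theorem isSecondFundamentalForm_iff (hF : ContDiffAt ℝ ∞ F p) (hp : p ∈ levelSet F c)
    (hreg : ∀ q ∈ levelSet F c, grad F q ≠ 0)
    (B : levelTangent F p →ₗ[ℝ] levelTangent F p →ₗ[ℝ] ℝ) :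
    IsSecondFundamentalForm F c p B ↔
      ∀ u v : levelTangent F p, B u v = -‖grad F p‖⁻¹ * inner ℝ (hess F p u) (v : Amb n) := by
  constructor
  · intro hB u v
    obtain ⟨V, hV, hVt, hVp⟩ := exists_extension hF hp hreg v.2
    rw [hB V hV hVt u v hVp, inner_covDeriv_unitNormal hF hp (hreg p hp) hV hVt u.2, hVp]
  · intro hB V hV hVt u v hVp
    rw [hB, inner_covDeriv_unitNormal hF hp (hreg p hp) hV hVt u.2, hVp]

theorem existsUnique_isSecondFundamentalForm (hF : ContDiffAt ℝ ∞ F p) (hp : p ∈ levelSet F c)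
    (hreg : ∀ q ∈ levelSet F c, grad F q ≠ 0) :
    ∃! B, IsSecondFundamentalForm F c p B := by
  refine ⟨LinearMap.mk₂ ℝ (fun u v : levelTangent F p =>
      -‖grad F p‖⁻¹ * inner ℝ (hess F p u) (v : Amb n)) ?_ ?_ ?_ ?_, ?_, ?_⟩
  · intro u u' v
    simp [inner_add_left, mul_add]
  · intro r u v
    simp [inner_smul_left, mul_left_comm]
  · intro u v v'
    simp [inner_add_right, mul_add]
  · intro r u v
    simp [inner_smul_right, mul_left_comm]
  · exact (isSecondFundamentalForm_iff hF hp hreg _).2 fun u v => rfl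
  · intro B hB
    ext u v
    exact (isSecondFundamentalForm_iff hF hp hreg B).1 hB u v

theorem trace_hess_starProjection (hF : ContDiffAt ℝ ∞ F p) (hp : p ∈ sphereProd n)
    (hG : grad F p ≠ 0) :
    LinearMap.trace ℝ (Amb n) ((hess F p ∘L (levelTangent F p).starProjection) ∘L
        (hess F p ∘L (levelTangent F p).starProjection)).toLinearMap
      = LinearMap.trace ℝ (Amb n) (hess F p ∘L hess F p).toLinearMap
        - 2 * ‖hess F p (unitNormal F p)‖ ^ 2
        + inner ℝ (hess F p (unitNormal F p)) (unitNormal F p) ^ 2 := by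
  set N := unitNormal F p
  -- Expand with `π = tangProj p - N ⊗ N`; the tangential projections are absorbed by `H`, leaving
  -- rank-one corrections.
  have h : (hess F p ∘L (levelTangent F p).starProjection) ∘L
      (hess F p ∘L (levelTangent F p).starProjection)
      = hess F p ∘L hess F p - InnerProductSpace.rankOne ℝ (hess F p (hess F p N)) N
        - InnerProductSpace.rankOne ℝ (hess F p N) (hess F p N)
        + inner ℝ (hess F p N) N • InnerProductSpace.rankOne ℝ (hess F p N) N := by
    rw [starProjection_levelTangent hp hG]
    ext1 v
    simp only [ContinuousLinearMap.comp_apply, _root_.add_apply, _root_.sub_apply,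
      _root_.smul_apply, InnerProductSpace.rankOne_apply, map_sub, map_smul, hess_tangProj hp,
      tangProj_hess hp, inner_hess_left hF hp, N]
    module
  rw [h]
  simp only [ContinuousLinearMap.toLinearMap_add, ContinuousLinearMap.toLinearMap_sub,
    ContinuousLinearMap.toLinearMap_smul, map_add, map_sub, map_smul, smul_eq_mul,
    InnerProductSpace.trace_rankOne, ← inner_hess_left hF hp N (hess F p N),
    real_inner_self_eq_norm_sq, ← inner_hess_left hF hp N N]
  ring

theorem formNormSq_eq (hF : ContDiffAt ℝ ∞ F p) (hp : p ∈ levelSet F c)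
    (hreg : ∀ q ∈ levelSet F c, grad F q ≠ 0)
    {B : levelTangent F p →ₗ[ℝ] levelTangent F p →ₗ[ℝ] ℝ}
    (hB : IsSecondFundamentalForm F c p B) :
    formNormSq B = 1 / ‖grad F p‖ ^ 2 *
      (LinearMap.trace ℝ (Amb n) (hess F p ∘L hess F p).toLinearMap
        - 2 * ‖hess F p (unitNormal F p)‖ ^ 2
        + inner ℝ (hess F p (unitNormal F p)) (unitNormal F p) ^ 2) := by
  rw [← trace_hess_starProjection hF hp.1 (hreg p hp),
    ← sum_sq_inner_eq_trace (inner_hess_left hF hp.1) (stdOrthonormalBasis ℝ (levelTangent F p)),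
    formNormSq]
  simp only [(isSecondFundamentalForm_iff hF hp hreg B).1 hB, mul_pow, ← Finset.mul_sum]
  simp

end

end SphereProd

end

theorem theorem1p3 (n : ℕ) (F : SphereProd.Amb n → ℝ) (U : Set (SphereProd.Amb n))
    (hU : IsOpen U) (hSU : SphereProd.sphereProd n ⊆ U) (hF : ContDiffOn ℝ ∞ F U) (c : ℝ)
    (hreg : ∀ p ∈ SphereProd.levelSet F c, SphereProd.grad F p ≠ 0)
    (hC : ∀ p ∈ SphereProd.levelSet F c, SphereProd.angleFun F p ^ 2 < 1) :
    ∀ p ∈ SphereProd.levelSet F c,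
      (∃! B, SphereProd.IsSecondFundamentalForm F c p B) ∧
      ∀ B, SphereProd.IsSecondFundamentalForm F c p B →
        SphereProd.formNormSq B =
          1 / ‖SphereProd.grad F p‖ ^ 2 *
            (1 / 2 * SphereProd.laplacian (SphereProd.gradSq F) p
              - inner ℝ (SphereProd.grad F p) (SphereProd.grad (SphereProd.laplacian F) p)
              - ((n : ℝ) - 1) * ‖SphereProd.grad F p‖ ^ 2
              - ‖SphereProd.grad (SphereProd.gradSq F) p‖ ^ 2 / (2 * ‖SphereProd.grad F p‖ ^ 2)
              + inner ℝ (SphereProd.grad (SphereProd.gradSq F) p) (SphereProd.grad F p) ^ 2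
                / (4 * ‖SphereProd.grad F p‖ ^ 4)) := by
  intro p hp
  have hev : ∀ᶠ q in 𝓝 p, ContDiffAt ℝ ∞ F q := by
    filter_upwards [hU.mem_nhds (hSU hp.1)] with q hq using hF.contDiffAt (hU.mem_nhds hq)
  have hFp := hev.self_of_nhds
  refine ⟨SphereProd.existsUnique_isSecondFundamentalForm hFp hp hreg, fun B hB => ?_⟩
  have hG : ‖SphereProd.grad F p‖ ≠ 0 := norm_ne_zero_iff.2 (hreg p hp)
  -- With `∇̄|∇̄F|² = 2 H ∇̄F` and `N = ∇̄F / |∇̄F|`, the last two terms of the formula are `-2|H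
  -- N|²` and `⟨H N, N⟩²`.
  rw [SphereProd.formNormSq_eq hFp hp hreg hB, SphereProd.bochner hev hp.1,
    SphereProd.grad_gradSq hFp hp.1, SphereProd.unitNormal]
  simp only [map_smul, norm_smul, norm_inv, norm_norm, inner_smul_left, inner_smul_right,
    conj_trivial, Real.norm_ofNat]
  field_simp
  ring
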